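/- **Theorem A.1.** Write $\langle f\rangle=\int_{-1}^{1}\int_0^\infty f(\mu,\omega)\,d\omega\,d\mu$, and let $$g^*(\omega)=\frac{\omega^2e^\omega}{(e^\omega-1)^2},\qquad M(\omega)=\frac{\omega g^*(\omega)}{\langle\omega g^*\rangle},\qquad \mathcal L g=-\omega g+M\langle\omega g\rangle .$$ For a reflection coefficient $\eta:(0,\infty)\to[0,1]$ and incoming data $\phi(t,\mu,\omega)\ge 0$ ($t>0$, $0<\mu\le1$, $\omega>0$), consider the linearized phonon transport problem for $g=g(t,x,\mu,\omega)$, $t\ge0$, $x\in[0,1]$, $\mu\in[-1,1]$, $\omega>0$: $$\partial_t g+\mu\omega\,\partial_x g=\mathcal L g,\qquad g|_{t=0}=0,\qquad g|_{x=0}=\phi\ \ (t>0,\ \mu>0),\qquad g(t,1,\mu,\omega)=\eta(\omega)\,g(t,1,-\mu,\omega)\ \ (t>0,\ \mu<0).$$ A solution is a measurable $g$ such that $\omega g(t,x,\cdot,\cdot)$ is integrable for every $t\ge0$ and $x\in[0,1]$, $\langle\omega|g|\rangle$ is bounded on $[0,T]\times[0,1]$ for every $T$, the equation holds in integrated form along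 every characteristic $r\mapsto(t+r,x+\mu\omega r)$ lying in $[0,\infty)\times[0,1]$, and the initial and boundary conditions hold pointwise. For a solution $g$ put $\mathcal M_\eta(\phi)(t)=\langle\omega g\rangle(t,0)/\langle\omega g^*\rangle$, the surface temperature. Let $\eta_1\ge\eta_2$ pointwise in $\omega$, with values in $[0,1]$, let $\alpha,\beta\in[0,1]$ with $\alpha+\beta=1$, let $\phi\ge0$, and let $g_1,g_2,g$ be solutions with the same incoming data $\phi$ and with reflection coefficients $\eta_1$, $\eta_2$, $\alpha\eta_1+\beta\eta_2$ respectively. Then, for every $t\ge0$, $$\alpha\,\mathcal M_{\eta_1}(\phi)(t)+\beta\,\mathcal M_{\eta_2}(\phi)(t)\ \ge\ \mathcal M_{\alpha\eta_1+\beta\eta_2}(\phi)(t),$$ and moreover $\alpha g_1+\beta g_2\ge g$ pointwise for all $t\ge0$, $x\in[0,1]$, $\mu\in[-1,1]$, $\omega>0$. -/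

import Mathlib

open Set MeasureTheory

noncomputable section

namespace PhononTransport

/-- The velocity-frequency space: direction `μ ∈ [-1, 1]`, frequency `ω ∈ (0, ∞)`. -/
def phase : Set (ℝ × ℝ) := Icc (-1) 1 ×ˢ Ioi 0

/-- The bracket `⟨f⟩ = ∫_{μ ∈ [-1,1]} ∫_{ω > 0} f(μ, ω) dω dμ`. -/
def bracket (f : ℝ → ℝ → ℝ) : ℝ := ∫ p in phase, f p.1 p.2

/-- `g^*(ω) = ω² e^ω / (e^ω - 1)²`. -/
def gStar (ω : ℝ) : ℝ := ω ^ 2 * Real.exp ω / (Real.exp ω - 1) ^ 2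

/-- The normalizing constant `⟨ω g^*⟩`. -/
def normConst : ℝ := bracket fun _ ω => ω * gStar ω

/-- The normalized Maxwellian `M(ω) = ω g^*(ω) / ⟨ω g^*⟩`. -/
def maxwellian (ω : ℝ) : ℝ := ω * gStar ω / normConst

/-- The moment `⟨ω g⟩(t, x)` of a density `g(t, x, μ, ω)`. -/
def moment (g : ℝ → ℝ → ℝ → ℝ → ℝ) (t x : ℝ) : ℝ := bracket fun μ ω => ω * g t x μ ω

/-- The linearized BGK operator `ℒ g = -ω g + M ⟨ω g⟩`, evaluated at `(t, x, μ, ω)`. -/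
def collision (g : ℝ → ℝ → ℝ → ℝ → ℝ) (t x μ ω : ℝ) : ℝ :=
  -ω * g t x μ ω + maxwellian ω * moment g t x

/-- The temperature `ΔT(t, x) = ⟨ω g⟩ / ⟨ω g^*⟩`. -/
def temperature (g : ℝ → ℝ → ℝ → ℝ → ℝ) (t x : ℝ) : ℝ := moment g t x / normConst

/-- The surface temperature `ΔT(t, x = 0)`: this is `ℳ_η(φ)(t)` when `g` is the solution with
reflection coefficient `η` and incoming data `φ`. -/
def surfaceTemperature (g : ℝ → ℝ → ℝ → ℝ → ℝ) (t : ℝ) : ℝ := temperature g t 0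

/-- The domain of the unknown: `t ≥ 0`, `x ∈ [0, 1]`, `μ ∈ [-1, 1]`, `ω > 0`. -/
def domain : Set (ℝ × ℝ × ℝ × ℝ) := Ici 0 ×ˢ Icc 0 1 ×ˢ phase

/-- `g` is a (mild) solution on `t ≥ 0`, `x ∈ [0, 1]` of `∂ₜ g + μ ω ∂ₓ g = ℒ g` with zero initial
datum, incoming data `φ(t, μ, ω)` at `x = 0` and reflection coefficient `η(ω)` at `x = 1`.
The equation is imposed in integrated form along every characteristic `r ↦ (t + r, x + μ ω r)`,
so that no compatibility of the data at the corners `t = 0`, `x ∈ {0, 1}` is needed.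
The values of `g` off `domain` are irrelevant. -/
structure IsSolution (η : ℝ → ℝ) (φ : ℝ → ℝ → ℝ → ℝ) (g : ℝ → ℝ → ℝ → ℝ → ℝ) : Prop where
  /-- joint measurability on the domain -/
  measurable : Measurable fun p : domain => g p.1.1 p.1.2.1 p.1.2.2.1 p.1.2.2.2
  /-- `ω g(t, x, ·, ·)` is integrable, so that `⟨ω g⟩(t, x)` is meaningful -/
  integrable : ∀ t, 0 ≤ t → ∀ x ∈ Icc (0 : ℝ) 1,
    IntegrableOn (fun p : ℝ × ℝ => p.2 * g t x p.1 p.2) phase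
  /-- `⟨ω |g|⟩` is bounded on `[0, T] × [0, 1]` for every `T` -/
  bounded : ∀ T : ℝ, ∃ C : ℝ, ∀ t ∈ Icc 0 T, ∀ x ∈ Icc (0 : ℝ) 1,
    bracket (fun μ ω => ω * |g t x μ ω|) ≤ C
  /-- the transport equation, integrated along characteristics -/
  transport : ∀ t, 0 ≤ t → ∀ x ∈ Icc (0 : ℝ) 1, ∀ μ ∈ Icc (-1 : ℝ) 1, ∀ ω, 0 < ω →
    ∀ s, 0 ≤ s → x + μ * ω * s ∈ Icc (0 : ℝ) 1 →
      IntervalIntegrable (fun r => collision g (t + r) (x + μ * ω * r) μ ω) volume 0 s ∧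
      g (t + s) (x + μ * ω * s) μ ω - g t x μ ω =
        ∫ r in (0 : ℝ)..s, collision g (t + r) (x + μ * ω * r) μ ω
  /-- zero initial datum -/
  initial : ∀ x ∈ Icc (0 : ℝ) 1, ∀ μ ∈ Icc (-1 : ℝ) 1, ∀ ω, 0 < ω → g 0 x μ ω = 0
  /-- incoming data at the surface `x = 0` -/
  inflow : ∀ t, 0 < t → ∀ μ ∈ Ioc (0 : ℝ) 1, ∀ ω, 0 < ω → g t 0 μ ω = φ t μ ω
  /-- reflection at the interface `x = 1` -/
  reflection : ∀ t, 0 < t → ∀ μ ∈ Ico (-1 : ℝ) 0, ∀ ω, 0 < ω →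
    g t 1 μ ω = η ω * g t 1 (-μ) ω

end PhononTransport

end

/-! Everything follows from a comparison principle, `IsTransported.nonneg`. If `⟨ωg⟩ ≥ -K e^t`, then
`g ≥ -K e^t M/(ω+1)`: the barrier is preserved along characteristics, at the inflow and under
reflection. Taking moments replaces `K` by `qK`, where `q = ⟨ωM/(ω+1)⟩ < 1`; iterating sends `K` to
`0`, so `g ≥ 0`. With `η = αη₁ + βη₂`, the difference `D = αg₁ + βg₂ - g` has zero initial and
inflow data, and at `x = 1` it satisfies `D(μ) = ηD(-μ) + αβ(η₁ - η₂)(g₁ - g₂)(-μ)`. The source is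
nonnegative by `IsSolution.mono`, itself an instance of comparison. -/

open MeasureTheory Set in
/-- A function with locally integrable derivative `G`, starting nonnegative, stays nonnegative if
`G` is nonnegative wherever the function is negative. -/
theorem nonneg_of_eq_add_integral {W G : ℝ → ℝ} {s : ℝ} (hs : 0 ≤ s)
    (hG : IntervalIntegrable G volume 0 s)
    (hW : ∀ r ∈ Icc 0 s, W r = W 0 + ∫ y in (0 : ℝ)..r, G y)
    (hneg : ∀ r ∈ Icc 0 s, W r < 0 → 0 ≤ G r) (h0 : 0 ≤ W 0) : 0 ≤ W s := by
  by_contra! hlt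
  have hcont : ContinuousOn W (Icc 0 s) := by
    have h := intervalIntegral.continuousOn_primitive_interval' hG left_mem_uIcc
    rw [uIcc_of_le hs] at h
    exact (continuousOn_const.add h).congr hW
  have hcomp : IsCompact (Icc 0 s ∩ W ⁻¹' Ici 0) :=
    isCompact_Icc.of_isClosed_subset
      (hcont.preimage_isClosed_of_isClosed isClosed_Icc isClosed_Ici) inter_subset_left
  -- `a` is the last time with `W ≥ 0`; beyond it `W < 0`, hence `G ≥ 0` and `W s ≥ W a`.
  obtain ⟨a, ⟨ha, haW⟩, hmax⟩ := hcomp.exists_isGreatest ⟨0, ⟨le_rfl, hs⟩, h0⟩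
  have hGa : IntervalIntegrable G volume 0 a :=
    hG.mono_set (by rw [uIcc_of_le hs, uIcc_of_le ha.1]; exact Icc_subset_Icc_right ha.2)
  have hdiff : W s - W a = ∫ y in a..s, G y := by
    rw [hW s ⟨hs, le_rfl⟩, hW a ha, ← intervalIntegral.integral_interval_sub_left hG hGa]
    ring
  have hint : 0 ≤ ∫ y in a..s, G y := by
    rw [intervalIntegral.integral_of_le ha.2]
    refine setIntegral_nonneg measurableSet_Ioc fun y hy => ?_
    have hy' : y ∈ Icc 0 s := ⟨ha.1.trans hy.1.le, hy.2⟩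
    refine hneg y hy' ?_
    by_contra! hge
    exact absurd (hmax ⟨hy', hge⟩) (not_le.2 hy.1)
  have : 0 ≤ W a := haW
  linarith

namespace PhononTransport

open MeasureTheory Set

/-! ### The Maxwellian and the contraction factor -/

theorem measurableSet_phase : MeasurableSet phase :=
  measurableSet_Icc.prod measurableSet_Ioi

theorem gStar_pos {ω : ℝ} (hω : 0 < ω) : 0 < gStar ω := by
  have : 0 < Real.exp ω - 1 := by linarith [Real.add_one_lt_exp hω.ne']
  unfold gStar
  positivity

theorem normConst_nonneg : 0 ≤ normConst :=
  setIntegral_nonneg measurableSet_phase fun _ hp =>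
    mul_nonneg (le_of_lt hp.2) (gStar_pos hp.2).le

theorem maxwellian_nonneg {ω : ℝ} (hω : 0 < ω) : 0 ≤ maxwellian ω :=
  div_nonneg (mul_nonneg hω.le (gStar_pos hω).le) normConst_nonneg

theorem integrableOn_maxwellian : IntegrableOn (fun p : ℝ × ℝ => maxwellian p.2) phase := by
  -- A divergent integral has the default value `0`, which would make `M` vanish; no convergence
  -- proof is needed.
  by_cases h : normConst = 0
  · simp [maxwellian, h, IntegrableOn]
  · have hI : IntegrableOn (fun p : ℝ × ℝ => p.2 * gStar p.2) phase := by
      by_contra hI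
      exact h (integral_undef hI)
    exact hI.div_const _

theorem volume_phase_pos : 0 < volume phase := by
  rw [phase, Measure.volume_eq_prod, Measure.prod_prod]
  simp

theorem integrableOn_maxwellian_div :
    IntegrableOn (fun p : ℝ × ℝ => maxwellian p.2 / (p.2 + 1)) phase := by
  refine Integrable.mono' integrableOn_maxwellian
    (integrableOn_maxwellian.aestronglyMeasurable.div₀
      (by fun_prop : Measurable fun p : ℝ × ℝ => p.2 + 1).aestronglyMeasurable) ?_
  filter_upwards [ae_restrict_mem measurableSet_phase] with p hp
  have hp2 : 0 < p.2 := hp.2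
  have := maxwellian_nonneg hp2
  rw [Real.norm_of_nonneg (by positivity)]
  exact div_le_self this (by linarith)

theorem integrableOn_mul_maxwellian_div :
    IntegrableOn (fun p : ℝ × ℝ => p.2 * (maxwellian p.2 / (p.2 + 1))) phase := by
  refine (integrableOn_maxwellian.sub integrableOn_maxwellian_div).congr_fun (fun p hp => ?_)
    measurableSet_phase
  have hp2 : 0 < p.2 := hp.2
  simp only [Pi.sub_apply]
  field_simp
  ring

theorem bracket_mul_maxwellian_div_nonneg :
    0 ≤ bracket fun _ ω => ω * (maxwellian ω / (ω + 1)) := by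
  refine setIntegral_nonneg measurableSet_phase fun p hp => ?_
  have hp2 : 0 < p.2 := hp.2
  have := maxwellian_nonneg hp2
  positivity

/-- The contraction factor of the collision operator weighted by `e^t`. -/
theorem bracket_mul_maxwellian_div_lt_one :
    bracket (fun _ ω => ω * (maxwellian ω / (ω + 1))) < 1 := by
  by_cases h : normConst = 0
  · simp [bracket, maxwellian, h]
  have hpos : 0 < normConst := lt_of_le_of_ne normConst_nonneg (Ne.symm h)
  have hone : ∫ p in phase, maxwellian p.2 = 1 := by
    simp only [maxwellian]
    rw [integral_div]
    exact div_self h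
  -- `ω/(ω+1) = 1 - 1/(ω+1)`, so the factor falls short of `⟨M⟩ = 1` by `⟨M/(ω+1)⟩ > 0`.
  have hsplit : bracket (fun _ ω => ω * (maxwellian ω / (ω + 1))) =
      (∫ p in phase, maxwellian p.2) - ∫ p in phase, maxwellian p.2 / (p.2 + 1) := by
    rw [← integral_sub integrableOn_maxwellian integrableOn_maxwellian_div]
    refine setIntegral_congr_fun measurableSet_phase fun p hp => ?_
    have hp2 : 0 < p.2 := hp.2
    simp only
    field_simp
    ring
  have hlt : 0 < ∫ p in phase, maxwellian p.2 / (p.2 + 1) := by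
    have key : ∀ p ∈ phase, 0 < maxwellian p.2 / (p.2 + 1) := fun p hp => by
      have hp2 : 0 < p.2 := hp.2
      have := gStar_pos hp2
      unfold maxwellian
      positivity
    rw [setIntegral_pos_iff_support_of_nonneg_ae _ integrableOn_maxwellian_div]
    · rw [inter_eq_right.2 (show phase ⊆ Function.support _ from fun p hp => (key p hp).ne')]
      exact volume_phase_pos
    · filter_upwards [ae_restrict_mem measurableSet_phase] with p hp
      exact (key p hp).le
  rw [hsplit, hone]
  linarith

/-! ### Transport without boundary conditions -/

/-- The interior part of the notion of solution: the transport equation along characteristics, the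
integrability of `ω g` and local boundedness of its moment, and the zero initial datum. -/
structure IsTransported (g : ℝ → ℝ → ℝ → ℝ → ℝ) : Prop where
  integrable : ∀ t, 0 ≤ t → ∀ x ∈ Icc (0 : ℝ) 1,
    IntegrableOn (fun p : ℝ × ℝ => p.2 * g t x p.1 p.2) phase
  bounded : ∀ T : ℝ, ∃ C : ℝ, ∀ t ∈ Icc 0 T, ∀ x ∈ Icc (0 : ℝ) 1, |moment g t x| ≤ C
  transport : ∀ t, 0 ≤ t → ∀ x ∈ Icc (0 : ℝ) 1, ∀ μ ∈ Icc (-1 : ℝ) 1, ∀ ω, 0 < ω →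
    ∀ s, 0 ≤ s → x + μ * ω * s ∈ Icc (0 : ℝ) 1 →
      IntervalIntegrable (fun r => collision g (t + r) (x + μ * ω * r) μ ω) volume 0 s ∧
      g (t + s) (x + μ * ω * s) μ ω - g t x μ ω =
        ∫ r in (0 : ℝ)..s, collision g (t + r) (x + μ * ω * r) μ ω
  initial : ∀ x ∈ Icc (0 : ℝ) 1, ∀ μ ∈ Icc (-1 : ℝ) 1, ∀ ω, 0 < ω → g 0 x μ ω = 0

theorem IsSolution.isTransported {η : ℝ → ℝ} {φ : ℝ → ℝ → ℝ → ℝ} {g : ℝ → ℝ → ℝ → ℝ → ℝ}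
    (hg : IsSolution η φ g) : IsTransported g where
  integrable := hg.integrable
  bounded T := by
    obtain ⟨C, hC⟩ := hg.bounded T
    refine ⟨C, fun t ht x hx => le_trans ?_ (hC t ht x hx)⟩
    refine (abs_integral_le_integral_abs).trans (le_of_eq ?_)
    refine setIntegral_congr_fun measurableSet_phase fun p hp => ?_
    simp only [abs_mul, abs_of_pos (show 0 < p.2 from hp.2)]
  transport := hg.transport
  initial := hg.initial

/-- A characteristic segment with endpoints in the slab stays in the slab. -/
theorem characteristic_mem_Icc {x v s r : ℝ} (hx : x ∈ Icc (0 : ℝ) 1)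
    (hs : x + v * s ∈ Icc (0 : ℝ) 1) (hr : r ∈ Icc 0 s) : x + v * r ∈ Icc (0 : ℝ) 1 := by
  obtain ⟨hx0, hx1⟩ := hx
  obtain ⟨hs0, hs1⟩ := hs
  obtain ⟨hr0, hrs⟩ := hr
  rcases le_total 0 v with hv | hv
  · have h1 := mul_le_mul_of_nonneg_left hrs hv
    have h2 := mul_nonneg hv hr0
    exact ⟨by linarith, by linarith⟩
  · have h1 := mul_le_mul_of_nonpos_left hrs hv
    have h2 := mul_nonpos_of_nonpos_of_nonneg hv hr0
    exact ⟨by linarith, by linarith⟩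

namespace IsTransported

variable {f g : ℝ → ℝ → ℝ → ℝ → ℝ}

theorem moment_linearCombination (hf : IsTransported f) (hg : IsTransported g) (a b : ℝ) {t x : ℝ}
    (ht : 0 ≤ t) (hx : x ∈ Icc (0 : ℝ) 1) :
    moment (fun t x μ ω => a * f t x μ ω + b * g t x μ ω) t x =
      a * moment f t x + b * moment g t x := by
  simp only [moment, bracket]
  rw [← integral_const_mul, ← integral_const_mul,
    ← integral_add ((hf.integrable t ht x hx).const_mul a) ((hg.integrable t ht x hx).const_mul b)]
  congr 1 with p
  ring

/-- Boundary conditions are left out so that solutions with different reflection coefficients can be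
combined. -/
theorem linearCombination (hf : IsTransported f) (hg : IsTransported g) (a b : ℝ) :
    IsTransported fun t x μ ω => a * f t x μ ω + b * g t x μ ω where
  integrable t ht x hx := by
    refine (((hf.integrable t ht x hx).const_mul a).add
      ((hg.integrable t ht x hx).const_mul b)).congr (.of_forall fun p => ?_)
    simp only [Pi.add_apply]
    ring
  bounded T := by
    obtain ⟨C, hC⟩ := hf.bounded T
    obtain ⟨D, hD⟩ := hg.bounded T
    refine ⟨|a| * C + |b| * D, fun t ht x hx => ?_⟩
    rw [moment_linearCombination hf hg a b ht.1 hx]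
    refine (abs_add_le _ _).trans ?_
    rw [abs_mul, abs_mul]
    gcongr
    exacts [hC t ht x hx, hD t ht x hx]
  transport t ht x hx μ hμ ω hω s hs hxs := by
    obtain ⟨hfi, hfe⟩ := hf.transport t ht x hx μ hμ ω hω s hs hxs
    obtain ⟨hgi, hge⟩ := hg.transport t ht x hx μ hμ ω hω s hs hxs
    have hcol : EqOn
        (fun r => a * collision f (t + r) (x + μ * ω * r) μ ω +
          b * collision g (t + r) (x + μ * ω * r) μ ω)
        (fun r => collision (fun t x μ ω => a * f t x μ ω + b * g t x μ ω)
          (t + r) (x + μ * ω * r) μ ω) (uIcc 0 s) := fun r hr => by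
      rw [uIcc_of_le hs] at hr
      simp only [collision]
      rw [moment_linearCombination hf hg a b (add_nonneg ht hr.1)
        (characteristic_mem_Icc hx hxs hr)]
      ring
    constructor
    · exact ((hfi.const_mul a).add (hgi.const_mul b)).congr (hcol.mono uIoc_subset_uIcc)
    · rw [← intervalIntegral.integral_congr hcol,
        intervalIntegral.integral_add (hfi.const_mul a) (hgi.const_mul b),
        intervalIntegral.integral_const_mul, intervalIntegral.integral_const_mul, ← hfe, ← hge]
      ring
  initial x hx μ hμ ω hω := by
    simp only [hf.initial x hx μ hμ ω hω, hg.initial x hx μ hμ ω hω]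
    ring

/-! ### The comparison principle -/

/-- Propagation of the lower barrier `-K e^t M(ω) / (ω + 1)` along a characteristic. -/
theorem barrier_propagates (hg : IsTransported g) {K T t x μ ω s : ℝ}
    (hK : ∀ t ∈ Icc 0 T, ∀ x ∈ Icc (0 : ℝ) 1, -(K * Real.exp t) ≤ moment g t x)
    (ht : 0 ≤ t) (hs : 0 ≤ s) (hT : t + s ≤ T) (hx : x ∈ Icc (0 : ℝ) 1)
    (hμ : μ ∈ Icc (-1 : ℝ) 1) (hω : 0 < ω) (hxs : x + μ * ω * s ∈ Icc (0 : ℝ) 1)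
    (h0 : 0 ≤ g t x μ ω + K * (maxwellian ω / (ω + 1)) * Real.exp t) :
    0 ≤ g (t + s) (x + μ * ω * s) μ ω + K * (maxwellian ω / (ω + 1)) * Real.exp (t + s) := by
  set c := K * (maxwellian ω / (ω + 1)) with hc
  have hcM : c * (ω + 1) = maxwellian ω * K := by
    rw [hc]
    field_simp
  have hexp : ∀ a b : ℝ, IntervalIntegrable (fun r => c * Real.exp (t + r)) volume a b :=
    fun a b => (by fun_prop : Continuous fun r => c * Real.exp (t + r)).intervalIntegrable a b
  -- Since `c(ω+1) = MK`, `G = -ωW + M(⟨ωg⟩ + K e^(t+r))`, which is nonnegative where `W < 0`.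
  refine nonneg_of_eq_add_integral
    (W := fun r => g (t + r) (x + μ * ω * r) μ ω + c * Real.exp (t + r))
    (G := fun r => collision g (t + r) (x + μ * ω * r) μ ω + c * Real.exp (t + r)) hs
    ((hg.transport t ht x hx μ hμ ω hω s hs hxs).1.add (hexp 0 s)) (fun r hr => ?_)
    (fun r hr hneg => ?_) (by simpa using h0)
  · obtain ⟨hi, he⟩ := hg.transport t ht x hx μ hμ ω hω r hr.1 (characteristic_mem_Icc hx hxs hr)
    rw [intervalIntegral.integral_add hi (hexp 0 r), ← he, intervalIntegral.integral_const_mul,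
      intervalIntegral.integral_comp_add_left (fun y => Real.exp y), integral_exp]
    simp only [mul_zero, add_zero]
    ring
  · have hm := hK (t + r) ⟨add_nonneg ht hr.1, by linarith [hr.2]⟩ (x + μ * ω * r)
      (characteristic_mem_Icc hx hxs hr)
    have hMm := mul_le_mul_of_nonneg_left hm (maxwellian_nonneg hω)
    have hWω := mul_neg_of_pos_of_neg hω hneg
    have hcE : maxwellian ω * (K * Real.exp (t + r)) = c * (ω + 1) * Real.exp (t + r) := by
      rw [hcM]
      ring
    simp only [collision]
    linarith

/-- A lower bound `-K e^t` for the moment gives the barrier `-K e^t M(ω) / (ω + 1)` for a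
supersolution. -/
theorem barrier_le (hg : IsTransported g) {η : ℝ → ℝ} (hη : ∀ ω, 0 < ω → η ω ∈ Icc (0 : ℝ) 1)
    (hin : ∀ t, 0 < t → ∀ μ ∈ Ioc (0 : ℝ) 1, ∀ ω, 0 < ω → 0 ≤ g t 0 μ ω)
    (hrefl : ∀ t, 0 < t → ∀ μ ∈ Ico (-1 : ℝ) 0, ∀ ω, 0 < ω → η ω * g t 1 (-μ) ω ≤ g t 1 μ ω)
    {K T : ℝ} (hK0 : 0 ≤ K)
    (hK : ∀ t ∈ Icc 0 T, ∀ x ∈ Icc (0 : ℝ) 1, -(K * Real.exp t) ≤ moment g t x)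
    {t x μ ω : ℝ} (ht : t ∈ Icc 0 T) (hx : x ∈ Icc (0 : ℝ) 1) (hμ : μ ∈ Icc (-1 : ℝ) 1)
    (hω : 0 < ω) : 0 ≤ g t x μ ω + K * (maxwellian ω / (ω + 1)) * Real.exp t := by
  have hc : 0 ≤ K * (maxwellian ω / (ω + 1)) :=
    mul_nonneg hK0 (div_nonneg (maxwellian_nonneg hω) (by linarith))
  -- tracing the characteristic back to time `t - s`
  have back : ∀ {t x μ s : ℝ}, t ∈ Icc 0 T → x ∈ Icc (0 : ℝ) 1 → μ ∈ Icc (-1 : ℝ) 1 →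
      s ∈ Icc 0 t → x - μ * ω * s ∈ Icc (0 : ℝ) 1 →
      0 ≤ g (t - s) (x - μ * ω * s) μ ω +
        K * (maxwellian ω / (ω + 1)) * Real.exp (t - s) →
      0 ≤ g t x μ ω + K * (maxwellian ω / (ω + 1)) * Real.exp t := by
    intro t x μ s ht hx hμ hs hxs h0
    have := hg.barrier_propagates hK (sub_nonneg.2 hs.2) hs.1 (by linarith [ht.2]) hxs hμ hω
      (by simpa using hx) h0
    simpa using this
  have backInitial : ∀ {t x μ : ℝ}, t ∈ Icc 0 T → x ∈ Icc (0 : ℝ) 1 → μ ∈ Icc (-1 : ℝ) 1 →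
      x - μ * ω * t ∈ Icc (0 : ℝ) 1 →
      0 ≤ g t x μ ω + K * (maxwellian ω / (ω + 1)) * Real.exp t := by
    intro t x μ ht hx hμ hxt
    refine back ht hx hμ ⟨ht.1, le_rfl⟩ hxt ?_
    rw [sub_self, hg.initial _ hxt μ hμ ω hω, zero_add]
    positivity
  have right : ∀ {t x μ : ℝ}, t ∈ Icc 0 T → x ∈ Icc (0 : ℝ) 1 → μ ∈ Ioc (0 : ℝ) 1 →
      0 ≤ g t x μ ω + K * (maxwellian ω / (ω + 1)) * Real.exp t := by
    intro t x μ ht hx hμ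
    have hμ' : μ ∈ Icc (-1 : ℝ) 1 := ⟨by linarith [hμ.1], hμ.2⟩
    have hv : 0 < μ * ω := mul_pos hμ.1 hω
    -- Corner hits go to the initial datum, because boundary data hold only at positive times.
    rcases le_or_gt 0 (x - μ * ω * t) with h | h
    · exact backInitial ht hx hμ' ⟨h, by linarith [hx.2, mul_nonneg hv.le ht.1]⟩
    · have hst : x / (μ * ω) < t := by
        rw [div_lt_iff₀ hv]
        linarith
      have hz : x - μ * ω * (x / (μ * ω)) = 0 := by
        rw [mul_div_cancel₀ x hv.ne', sub_self]
      refine back ht hx hμ' ⟨div_nonneg hx.1 hv.le, hst.le⟩ (by simp [hz]) ?_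
      rw [hz]
      have := hin _ (sub_pos.2 hst) μ hμ ω hω
      positivity
  rcases lt_trichotomy μ 0 with hneg | rfl | hpos
  · have hv : 0 < -(μ * ω) := by linarith [mul_neg_of_neg_of_pos hneg hω]
    rcases le_or_gt (x - μ * ω * t) 1 with h | h
    · exact backInitial ht hx hμ ⟨by linarith [hx.1, mul_nonneg hv.le ht.1], h⟩
    · have hst : (1 - x) / -(μ * ω) < t := by
        rw [div_lt_iff₀ hv]
        linarith
      have hz : x - μ * ω * ((1 - x) / -(μ * ω)) = 1 := by
        linarith [mul_div_cancel₀ (1 - x) hv.ne']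
      have hs0 : 0 ≤ (1 - x) / -(μ * ω) := div_nonneg (by linarith [hx.2]) hv.le
      refine back ht hx hμ ⟨hs0, hst.le⟩ (by simp [hz]) ?_
      rw [hz]
      have hr := hrefl _ (sub_pos.2 hst) μ ⟨hμ.1, hneg⟩ ω hω
      -- The reflected value comes from a right-moving characteristic, already treated; `η ≤ 1`
      -- absorbs the remaining `(1 - η)` share of the barrier.
      have hplus := right (t := t - (1 - x) / -(μ * ω)) (x := 1) (μ := -μ)
        ⟨(sub_pos.2 hst).le, by linarith [ht.2]⟩ (by simp) ⟨by linarith, by linarith [hμ.1]⟩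
      have h1 := mul_nonneg (hη ω hω).1 hplus
      have h2 := mul_nonneg (sub_nonneg.2 (hη ω hω).2)
        (mul_nonneg hc (Real.exp_pos (t - (1 - x) / -(μ * ω))).le)
      linarith
  · exact backInitial ht hx hμ (by simpa using hx)
  · exact right ht hx ⟨hpos, hμ.2⟩

/-- Comparison principle: a supersolution of the transport problem is nonnegative. -/
theorem nonneg (hg : IsTransported g) {η : ℝ → ℝ} (hη : ∀ ω, 0 < ω → η ω ∈ Icc (0 : ℝ) 1)
    (hin : ∀ t, 0 < t → ∀ μ ∈ Ioc (0 : ℝ) 1, ∀ ω, 0 < ω → 0 ≤ g t 0 μ ω)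
    (hrefl : ∀ t, 0 < t → ∀ μ ∈ Ico (-1 : ℝ) 0, ∀ ω, 0 < ω → η ω * g t 1 (-μ) ω ≤ g t 1 μ ω)
    {t x μ ω : ℝ} (ht : 0 ≤ t) (hx : x ∈ Icc (0 : ℝ) 1) (hμ : μ ∈ Icc (-1 : ℝ) 1)
    (hω : 0 < ω) : 0 ≤ g t x μ ω := by
  set q := bracket fun _ ω => ω * (maxwellian ω / (ω + 1)) with hq
  have hq0 : 0 ≤ q := bracket_mul_maxwellian_div_nonneg
  have improve : ∀ K, 0 ≤ K →
      (∀ s ∈ Icc 0 t, ∀ x ∈ Icc (0 : ℝ) 1, -(K * Real.exp s) ≤ moment g s x) →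
      ∀ s ∈ Icc 0 t, ∀ x ∈ Icc (0 : ℝ) 1, -(q * K * Real.exp s) ≤ moment g s x := by
    intro K hK0 hK s hs x hx
    have heq : -(q * K * Real.exp s) =
        ∫ p in phase, -(K * Real.exp s) * (p.2 * (maxwellian p.2 / (p.2 + 1))) := by
      rw [integral_const_mul, hq, bracket]
      ring
    rw [heq]
    refine setIntegral_mono_on (integrableOn_mul_maxwellian_div.const_mul _)
      (hg.integrable s hs.1 x hx) measurableSet_phase fun p hp => ?_
    have := mul_nonneg (le_of_lt hp.2) (hg.barrier_le hη hin hrefl hK0 hK hs hx hp.1 hp.2)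
    linarith
  obtain ⟨C, hC⟩ := hg.bounded t
  have hC0 : 0 ≤ C := (abs_nonneg _).trans (hC t ⟨ht, le_rfl⟩ x hx)
  have iter : ∀ n : ℕ, ∀ s ∈ Icc 0 t, ∀ x ∈ Icc (0 : ℝ) 1,
      -(q ^ n * C * Real.exp s) ≤ moment g s x := by
    intro n
    induction n with
    | zero =>
      intro s hs x hx
      have h1 := neg_le_of_abs_le (hC s hs x hx)
      have h2 := mul_le_mul_of_nonneg_left (Real.one_le_exp hs.1) hC0
      linarith
    | succ n ih =>
      have := improve (q ^ n * C) (by positivity) ih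
      simpa [pow_succ', mul_assoc] using this
  -- Limit `n → ∞`: the moment is nonnegative, and the barrier with `K = 0` gives the claim.
  have hmom : ∀ s ∈ Icc 0 t, ∀ x ∈ Icc (0 : ℝ) 1, -((0 : ℝ) * Real.exp s) ≤ moment g s x := by
    intro s hs x hx
    have hlim := ((tendsto_pow_atTop_nhds_zero_of_lt_one hq0
      bracket_mul_maxwellian_div_lt_one).mul_const C).mul_const (Real.exp s)
    rw [zero_mul] at hlim
    exact le_of_tendsto' hlim.neg fun n => iter n s hs x hx
  simpa using hg.barrier_le hη hin hrefl le_rfl hmom ⟨ht, le_rfl⟩ hx hμ hω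

end IsTransported

/-! ### Monotonicity and convexity in the reflection coefficient -/

variable {η η₁ η₂ : ℝ → ℝ} {φ : ℝ → ℝ → ℝ → ℝ} {g g₁ g₂ : ℝ → ℝ → ℝ → ℝ → ℝ}

theorem IsSolution.nonneg (hg : IsSolution η φ g) (hη : ∀ ω, 0 < ω → η ω ∈ Icc (0 : ℝ) 1)
    (hφ : ∀ t, 0 < t → ∀ μ ∈ Ioc (0 : ℝ) 1, ∀ ω, 0 < ω → 0 ≤ φ t μ ω)
    {t x μ ω : ℝ} (ht : 0 ≤ t) (hx : x ∈ Icc (0 : ℝ) 1) (hμ : μ ∈ Icc (-1 : ℝ) 1)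
    (hω : 0 < ω) : 0 ≤ g t x μ ω :=
  hg.isTransported.nonneg hη
    (fun t ht μ hμ ω hω => (hφ t ht μ hμ ω hω).trans_eq (hg.inflow t ht μ hμ ω hω).symm)
    (fun t ht μ hμ ω hω => (hg.reflection t ht μ hμ ω hω).ge) ht hx hμ hω

/-- Solutions are monotone in the reflection coefficient. -/
theorem IsSolution.mono (hg₁ : IsSolution η₁ φ g₁) (hg₂ : IsSolution η₂ φ g₂)
    (hη₁ : ∀ ω, 0 < ω → η₁ ω ∈ Icc (0 : ℝ) 1) (hη₂ : ∀ ω, 0 < ω → η₂ ω ∈ Icc (0 : ℝ) 1)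
    (hη : ∀ ω, 0 < ω → η₂ ω ≤ η₁ ω)
    (hφ : ∀ t, 0 < t → ∀ μ ∈ Ioc (0 : ℝ) 1, ∀ ω, 0 < ω → 0 ≤ φ t μ ω)
    {t x μ ω : ℝ} (ht : 0 ≤ t) (hx : x ∈ Icc (0 : ℝ) 1) (hμ : μ ∈ Icc (-1 : ℝ) 1)
    (hω : 0 < ω) : g₂ t x μ ω ≤ g₁ t x μ ω := by
  have key := (hg₁.isTransported.linearCombination hg₂.isTransported 1 (-1)).nonneg hη₁
    (fun t ht μ hμ ω hω => by
      simp only [hg₁.inflow t ht μ hμ ω hω, hg₂.inflow t ht μ hμ ω hω]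
      linarith)
    -- The reflection defect of `g₁ - g₂` relative to `η₁` is `(η₁ - η₂) g₂(-μ)`.
    (fun t ht μ hμ ω hω => by
      have hpos := hg₂.nonneg hη₂ hφ ht.le (x := 1) (μ := -μ) (by simp)
        ⟨by linarith [hμ.2], by linarith [hμ.1]⟩ hω
      have := mul_nonneg (sub_nonneg.2 (hη ω hω)) hpos
      simp only [hg₁.reflection t ht μ hμ ω hω, hg₂.reflection t ht μ hμ ω hω]
      linarith) ht hx hμ hω
  linarith

end PhononTransport

open PhononTransport in
theorem theoremA1
    (η₁ η₂ : ℝ → ℝ)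
    (hη₁ : ∀ ω, 0 < ω → η₁ ω ∈ Set.Icc (0 : ℝ) 1)
    (hη₂ : ∀ ω, 0 < ω → η₂ ω ∈ Set.Icc (0 : ℝ) 1)
    (hη : ∀ ω, 0 < ω → η₂ ω ≤ η₁ ω)
    (α β : ℝ) (hα : α ∈ Set.Icc (0 : ℝ) 1) (hβ : β ∈ Set.Icc (0 : ℝ) 1) (hαβ : α + β = 1)
    (φ : ℝ → ℝ → ℝ → ℝ)
    (hφ : ∀ t, 0 < t → ∀ μ ∈ Set.Ioc (0 : ℝ) 1, ∀ ω, 0 < ω → 0 ≤ φ t μ ω)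
    (g₁ g₂ g : ℝ → ℝ → ℝ → ℝ → ℝ)
    (hg₁ : PhononTransport.IsSolution η₁ φ g₁)
    (hg₂ : PhononTransport.IsSolution η₂ φ g₂)
    (hg : PhononTransport.IsSolution (fun ω => α * η₁ ω + β * η₂ ω) φ g) :
    (∀ t, 0 ≤ t →
      PhononTransport.surfaceTemperature g t ≤
        α * PhononTransport.surfaceTemperature g₁ t +
          β * PhononTransport.surfaceTemperature g₂ t) ∧
    (∀ t, 0 ≤ t → ∀ x ∈ Set.Icc (0 : ℝ) 1, ∀ μ ∈ Set.Icc (-1 : ℝ) 1, ∀ ω, 0 < ω →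
      g t x μ ω ≤ α * g₁ t x μ ω + β * g₂ t x μ ω) := by
  have hconv : ∀ ω, 0 < ω → α * η₁ ω + β * η₂ ω ∈ Set.Icc (0 : ℝ) 1 := fun ω hω =>
    convex_Icc (0 : ℝ) 1 (hη₁ ω hω) (hη₂ ω hω) hα.1 hβ.1 hαβ
  have h12 := hg₁.isTransported.linearCombination hg₂.isTransported α β
  have hle : ∀ t, 0 ≤ t → ∀ x ∈ Set.Icc (0 : ℝ) 1, ∀ μ ∈ Set.Icc (-1 : ℝ) 1, ∀ ω, 0 < ω →
      g t x μ ω ≤ α * g₁ t x μ ω + β * g₂ t x μ ω := by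
    intro t ht x hx μ hμ ω hω
    obtain rfl : β = 1 - α := by linarith
    have key := (h12.linearCombination hg.isTransported 1 (-1)).nonneg hconv
      (fun t ht μ hμ ω hω => by
        simp only [hg₁.inflow t ht μ hμ ω hω, hg₂.inflow t ht μ hμ ω hω, hg.inflow t ht μ hμ ω hω]
        linarith)
      (fun t ht μ hμ ω hω => by
        have hmono := hg₁.mono hg₂ hη₁ hη₂ hη hφ ht.le (x := 1) (μ := -μ) (by simp)
          ⟨by linarith [hμ.2], by linarith [hμ.1]⟩ hω
        -- This is the source `αβ(η₁ - η₂)(g₁ - g₂)`, with `β` written as `1 - α`.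
        have hcorr := mul_nonneg (mul_nonneg hα.1 hβ.1)
          (mul_nonneg (sub_nonneg.2 (hη ω hω)) (sub_nonneg.2 hmono))
        simp only [hg₁.reflection t ht μ hμ ω hω, hg₂.reflection t ht μ hμ ω hω,
          hg.reflection t ht μ hμ ω hω]
        linarith) ht hx hμ hω
    linarith
  refine ⟨fun t ht => ?_, hle⟩
  have h0 : (0 : ℝ) ∈ Set.Icc (0 : ℝ) 1 := by simp
  have hmom : moment g t 0 ≤ α * moment g₁ t 0 + β * moment g₂ t 0 := by
    rw [← hg₁.isTransported.moment_linearCombination hg₂.isTransported α β ht h0]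
    exact MeasureTheory.setIntegral_mono_on (hg.integrable t ht 0 h0) (h12.integrable t ht 0 h0)
      measurableSet_phase fun p hp =>
        mul_le_mul_of_nonneg_left (hle t ht 0 h0 p.1 hp.1 p.2 hp.2) (le_of_lt hp.2)
  have := div_le_div_of_nonneg_right hmom normConst_nonneg
  simp only [surfaceTemperature, temperature]
  rwa [add_div, mul_div_assoc, mul_div_assoc] at this
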